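/- Let $N\ge 0$ be an integer. For finite $\Lambda\subset\mathbb Z$ let $\mathcal A(\Lambda)$ be the algebra of all linear operators on $\bigotimes_{x\in\Lambda}\mathbb C^{N+1}$, let $\mathcal A(\Lambda_1)\subset\mathcal A(\Lambda_2)$ for $\Lambda_1\subset\Lambda_2$ be the natural inclusion, and let $\mathcal A=\overline{\bigcup_{\Lambda}\mathcal A(\Lambda)}^{\|\cdot\|}$ be the quasi-local $C^*$-algebra of the spin chain, with translations $\tau_x$, $x\in\mathbb Z$. Let $\Phi$ be a translation invariant potential: for each finite $X\subset\mathbb Z$ a self-adjoint $\Phi(X)\in\mathcal A(X)$, with $\tau_x(\Phi(X))=\Phi(X+x)$. Assume that for some $\lambda>0$ $$\|\Phi\|_\lambda:=\sum_{X\ni 0}|X|\,(N+1)^{2|X|}\,e^{\lambda D(X)}\,\|\Phi(X)\|<\infty,\qquad D(X)=\max_{x,y\in X}|x-y| .$$ Put $H_\Lambda=\sum_{V\subset\Lambda}\Phi(V)$ and $\alpha^\Lambda_t(A)=e^{itH_\Lambda}Ae^{-itH_\Lambda}$ for finite $\Lambda\subset\mathbb Z$. For $A\in\mathcal A$ and $x\in\mathbb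 Z$ put $$F_x(A)=\sup_{0\ne a\in\mathcal A(\{0\})}\frac{\|[A,\tau_x(a)]\|}{\|a\|},\qquad \mathcal A_{\exp}=\Bigl\{A\in\mathcal A:\ \exists\,\mu>0,\ \lim_{|x|\to\infty}e^{\mu|x|}F_x(A)=0\Bigr\}.$$ **Theorem.** The dynamics exists: there is a (necessarily unique) one-parameter group $(\alpha_t)_{t\in\mathbb R}$ of $*$-automorphisms of $\mathcal A$ such that $\lim_{\Lambda\to\mathbb Z}\|\alpha_t(A)-\alpha^\Lambda_t(A)\|=0$ for all $t\in\mathbb R$ and $A\in\mathcal A$, the limit being taken along the finite subsets of $\mathbb Z$ directed by inclusion. Moreover $\mathcal A_{\exp}$ is a $*$-subalgebra of $\mathcal A$, and $\alpha_t(\mathcal A_{\exp})=\mathcal A_{\exp}$ for every $t\in\mathbb R$. -/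

import Mathlib

open scoped InnerProductSpace lp

noncomputable section

namespace SpinChain

/-! ### The quasi-local algebra of the spin chain

The C*-inductive limit of the matrix algebras on `⊗_{x ∈ Λ} ℂ^(N+1)`, with `Λ` running over the
finite subsets of `ℤ`, is realised concretely on the Hilbert space `ℓ²` of all classical
configurations: a matrix on `⊗_{x ∈ Λ} ℂ^(N+1)` acts on the coordinates in `Λ` and leaves the others
alone. -/

/-- Classical configurations; they index the product basis. -/
abbrev Config (N : ℕ) : Type := ℤ → Fin (N + 1)

/-- Configurations in `Λ`; they index the product basis of `⊗_{x ∈ Λ} ℂ^(N+1)`. -/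
abbrev LocConfig (N : ℕ) (Λ : Finset ℤ) : Type := Λ → Fin (N + 1)

/-- The Hilbert space `ℓ²(Config N)`. -/
abbrev Hil (N : ℕ) : Type := ℓ²(Config N, ℂ)

/-- Bounded operators, with the operator norm. -/
abbrev Op (N : ℕ) : Type := Hil N →L[ℂ] Hil N

/-- The restriction of a configuration to `Λ`. -/
def restr {N : ℕ} (Λ : Finset ℤ) (σ : Config N) : LocConfig N Λ := fun x => σ x

/-- The configuration equal to `η` in `Λ` and to `σ` outside. -/
def merge {N : ℕ} {Λ : Finset ℤ} (σ : Config N) (η : LocConfig N Λ) : Config N :=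
  fun x => if h : x ∈ Λ then η ⟨x, h⟩ else σ x

@[simp] theorem restr_merge {N : ℕ} {Λ : Finset ℤ} (σ : Config N) (η : LocConfig N Λ) :
    restr Λ (merge σ η) = η := by
  funext x; simp [restr, merge]

@[simp] theorem merge_merge {N : ℕ} {Λ : Finset ℤ} (σ : Config N) (η ζ : LocConfig N Λ) :
    merge (merge σ η) ζ = merge σ ζ := by
  funext x; by_cases h : x ∈ Λ <;> simp [merge, h]

@[simp] theorem merge_restr {N : ℕ} {Λ : Finset ℤ} (σ : Config N) :
    merge σ (restr Λ σ) = σ := by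
  funext x; simp [restr, merge]

theorem merge_injOn {N : ℕ} {Λ : Finset ℤ} (ζ η : LocConfig N Λ) :
    Set.InjOn (fun σ : Config N => merge σ η) {σ | restr Λ σ = ζ} := by
  intro σ hσ τ hτ h
  have h2 := congrArg (fun ρ => merge ρ ζ) h
  simp only [merge_merge] at h2
  rw [← merge_restr (Λ := Λ) σ, ← merge_restr (Λ := Λ) τ, hσ, hτ, h2]

theorem matrixUnit_bound {N : ℕ} {Λ : Finset ℤ} (ζ η : LocConfig N Λ) (ψ : Hil N)
    (s : Finset (Config N)) :
    ∑ σ ∈ s, ‖(if restr Λ σ = ζ then ψ (merge σ η) else 0 : ℂ)‖ ^ (2 : ENNReal).toReal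
      ≤ ‖ψ‖ ^ (2 : ENNReal).toReal := by
  classical
  have h1 : ∑ σ ∈ s, ‖(if restr Λ σ = ζ then ψ (merge σ η) else 0 : ℂ)‖ ^ (2 : ENNReal).toReal
      = ∑ σ ∈ s.filter (fun σ => restr Λ σ = ζ), ‖ψ (merge σ η)‖ ^ (2 : ENNReal).toReal := by
    rw [Finset.sum_filter]
    refine Finset.sum_congr rfl fun σ _ => ?_
    split_ifs <;> simp
  rw [h1, ← Finset.sum_image (f := fun τ => ‖ψ τ‖ ^ (2 : ENNReal).toReal)
    (g := fun σ => merge σ η)]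
  · exact lp.sum_rpow_le_norm_rpow (by norm_num) ψ _
  · intro σ hσ τ hτ h
    exact merge_injOn ζ η (by simpa using (Finset.mem_filter.1 hσ).2)
      (by simpa using (Finset.mem_filter.1 hτ).2) h

/-- The matrix unit `|ζ⟩⟨η|` on `⊗_{x ∈ Λ} ℂ^(N+1)`, tensored with the identity outside `Λ`. -/
def matrixUnit {N : ℕ} {Λ : Finset ℤ} (ζ η : LocConfig N Λ) : Op N :=
  LinearMap.mkContinuous
    { toFun := fun ψ => ⟨fun σ => if restr Λ σ = ζ then ψ (merge σ η) else 0,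
        memℓp_gen' (matrixUnit_bound ζ η ψ)⟩
      map_add' := fun ψ φ => by
        ext σ
        change (if restr Λ σ = ζ then ψ (merge σ η) + φ (merge σ η) else 0)
          = (if restr Λ σ = ζ then ψ (merge σ η) else 0)
            + (if restr Λ σ = ζ then φ (merge σ η) else 0)
        split_ifs <;> simp
      map_smul' := fun c ψ => by
        ext σ
        by_cases h : restr Λ σ = ζ <;> simp [h] }
    1 (fun ψ => by
      rw [one_mul]
      exact lp.norm_le_of_forall_sum_le (by norm_num) (norm_nonneg _) (matrixUnit_bound ζ η ψ))

@[simp] theorem matrixUnit_apply {N : ℕ} {Λ : Finset ℤ} (ζ η : LocConfig N Λ) (ψ : Hil N)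
    (σ : Config N) :
    matrixUnit ζ η ψ σ = if restr Λ σ = ζ then ψ (merge σ η) else 0 := rfl

theorem star_matrixUnit {N : ℕ} {Λ : Finset ℤ} (ζ η : LocConfig N Λ) :
    star (matrixUnit ζ η) = matrixUnit η ζ := by
  rw [ContinuousLinearMap.star_eq_adjoint]
  symm
  rw [ContinuousLinearMap.eq_adjoint_iff]
  intro ψ φ
  rw [lp.inner_eq_tsum, lp.inner_eq_tsum]
  let e : {σ : Config N | restr Λ σ = η} ≃ {σ : Config N | restr Λ σ = ζ} :=
    { toFun := fun σ => ⟨merge σ.1 ζ, by simp⟩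
      invFun := fun σ => ⟨merge σ.1 η, by simp⟩
      left_inv := fun σ => by
        have h : restr Λ σ.1 = η := σ.2
        apply Subtype.ext
        simp [← h]
      right_inv := fun σ => by
        have h : restr Λ σ.1 = ζ := σ.2
        apply Subtype.ext
        simp [← h] }
  have h1 : ∀ σ : Config N, ⟪matrixUnit η ζ ψ σ, φ σ⟫_ℂ
      = Set.indicator {σ : Config N | restr Λ σ = η} (fun σ => ⟪ψ (merge σ ζ), φ σ⟫_ℂ) σ := by
    intro σ
    by_cases h : restr Λ σ = η <;> simp [h]
  have h2 : ∀ σ : Config N, ⟪ψ σ, matrixUnit ζ η φ σ⟫_ℂ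
      = Set.indicator {σ : Config N | restr Λ σ = ζ} (fun σ => ⟪ψ σ, φ (merge σ η)⟫_ℂ) σ := by
    intro σ
    by_cases h : restr Λ σ = ζ <;> simp [h]
  simp_rw [h1, h2]
  rw [← tsum_subtype, ← tsum_subtype, ← e.tsum_eq]
  refine tsum_congr fun σ => ?_
  have h : restr Λ σ.1 = η := σ.2
  simp [e, ← h]

/-- The action of a matrix on `⊗_{x ∈ Λ} ℂ^(N+1)` on the coordinates in `Λ`, as an operator. -/
def localOp {N : ℕ} {Λ : Finset ℤ} (M : Matrix (LocConfig N Λ) (LocConfig N Λ) ℂ) : Op N :=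
  ∑ ζ, ∑ η, M ζ η • matrixUnit ζ η

theorem localOp_apply {N : ℕ} {Λ : Finset ℤ} (M : Matrix (LocConfig N Λ) (LocConfig N Λ) ℂ)
    (ψ : Hil N) (σ : Config N) :
    localOp M ψ σ = ∑ η, M (restr Λ σ) η * ψ (merge σ η) := by
  simp only [localOp, sum_apply, smul_apply,
    lp.coeFn_sum, Finset.sum_apply, lp.coeFn_smul, Pi.smul_apply, matrixUnit_apply, smul_eq_mul]
  rw [Finset.sum_comm]
  refine Finset.sum_congr rfl fun η _ => ?_
  simp

/-- The representation `M ↦ M ⊗ 1` of the matrix algebra on `⊗_{x ∈ Λ} ℂ^(N+1)`. -/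
def localRep (N : ℕ) (Λ : Finset ℤ) :
    Matrix (LocConfig N Λ) (LocConfig N Λ) ℂ →⋆ₐ[ℂ] Op N where
  toFun := localOp
  map_one' := by
    ext ψ σ
    simp [localOp_apply, Matrix.one_apply]
  map_mul' M M' := by
    ext ψ σ
    simp only [localOp_apply, mul_apply_eq_comp, Matrix.mul_apply, restr_merge,
      merge_merge, Finset.sum_mul, Finset.mul_sum]
    rw [Finset.sum_comm]
    simp [mul_assoc]
  map_zero' := by simp [localOp]
  map_add' M M' := by simp [localOp, add_smul, Finset.sum_add_distrib]
  commutes' c := by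
    ext ψ σ
    simp [localOp_apply, Algebra.algebraMap_eq_smul_one, Matrix.one_apply]
  map_star' M := by
    simp only [localOp, star_sum, star_smul, star_matrixUnit, Matrix.star_apply]
    rw [Finset.sum_comm]

/-- The algebra `𝒜(Λ)` of observables of the finite region `Λ`. -/
def localAlg (N : ℕ) (Λ : Finset ℤ) : StarSubalgebra ℂ (Op N) := (localRep N Λ).range

theorem localAlg_mono (N : ℕ) : Monotone (localAlg N) := by
  intro Λ Λ' h
  rintro _ ⟨M, rfl⟩
  let p : LocConfig N Λ' → LocConfig N Λ := fun η x => η ⟨x, h x.2⟩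
  refine ⟨Matrix.of fun ζ η =>
    if (∀ x : Λ', x.1 ∉ Λ → ζ x = η x) then M (p ζ) (p η) else 0, ?_⟩
  ext ψ σ
  change localOp _ ψ σ = localOp M ψ σ
  rw [localOp_apply, localOp_apply]
  simp only [Matrix.of_apply, ite_mul, zero_mul]
  rw [← Finset.sum_filter]
  refine Finset.sum_bij' (fun η _ => p η) (fun η _ => restr Λ' (merge σ η)) ?_ ?_ ?_ ?_ ?_
  · simp
  · intro η _
    simp only [Finset.mem_filter, Finset.mem_univ, true_and]
    intro x hx
    simp [restr, merge, hx]
  · intro η hη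
    simp only [Finset.mem_filter, Finset.mem_univ, true_and] at hη
    funext x
    by_cases hx : x.1 ∈ Λ
    · simp [restr, merge, hx, p]
    · simpa [restr, merge, hx] using hη x hx
  · intro η _
    funext x
    simp [restr, merge, p]
  · intro η hη
    simp only [Finset.mem_filter, Finset.mem_univ, true_and] at hη
    congr 1
    refine congrArg (fun τ => ψ τ) (funext fun x => ?_)
    by_cases hx : x ∈ Λ
    · simp [merge, hx, h hx, p]
    · by_cases hx' : x ∈ Λ'
      · have := hη ⟨x, hx'⟩ hx
        simp [merge, hx, hx', ← this, restr]
      · simp [merge, hx, hx']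

/-- The quasi-local algebra: the norm closure of the union of the `𝒜(Λ)`
(see `coe_quasiLocal`). -/
def quasiLocal (N : ℕ) : StarSubalgebra ℂ (Op N) :=
  (⨆ Λ : Finset ℤ, localAlg N Λ).topologicalClosure

theorem coe_quasiLocal (N : ℕ) :
    (quasiLocal N : Set (Op N)) = closure (⋃ Λ : Finset ℤ, (localAlg N Λ : Set (Op N))) := by
  rw [quasiLocal, StarSubalgebra.topologicalClosure_coe,
    StarSubalgebra.coe_iSup_of_directed (localAlg_mono N).directed_le]

/-! ### Translations -/

/-- The unitary of `ℓ²` induced by a permutation of the configurations. -/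
def permUnitary {N : ℕ} (e : Equiv.Perm (Config N)) : Hil N ≃ₗᵢ[ℂ] Hil N where
  toFun ψ := ⟨fun σ => ψ (e σ), memℓp_gen
    (((lp.memℓp ψ).summable (by norm_num)).comp_injective e.injective)⟩
  invFun ψ := ⟨fun σ => ψ (e.symm σ), memℓp_gen
    (((lp.memℓp ψ).summable (by norm_num)).comp_injective e.symm.injective)⟩
  left_inv ψ := by ext σ; simp
  right_inv ψ := by ext σ; simp
  map_add' ψ φ := by ext σ; rfl
  map_smul' c ψ := by ext σ; simp
  norm_map' ψ := by
    rw [lp.norm_eq_tsum_rpow (by norm_num), lp.norm_eq_tsum_rpow (by norm_num)]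
    congr 1
    exact e.tsum_eq (fun σ => ‖ψ σ‖ ^ (2 : ENNReal).toReal)

/-- The shift `σ ↦ (y ↦ σ (y + x))` of configurations. -/
def shift (N : ℕ) (x : ℤ) : Equiv.Perm (Config N) where
  toFun σ := fun y => σ (y + x)
  invFun σ := fun y => σ (y - x)
  left_inv σ := by funext y; simp
  right_inv σ := by funext y; simp

/-- The translation automorphism `τ_x`; it carries `𝒜(Λ)` to `𝒜(Λ + x)`
(see `map_translate_localAlg_le`). -/
def translate (N : ℕ) (x : ℤ) : Op N ≃⋆ₐ[ℂ] Op N :=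
  (permUnitary (shift N x)).conjStarAlgEquiv

/-- The region `Λ + x`. -/
def shiftFinset (Λ : Finset ℤ) (x : ℤ) : Finset ℤ := Λ.image (fun y => y + x)

theorem map_translate_localAlg_le (N : ℕ) (x : ℤ) (Λ : Finset ℤ) (a : Op N)
    (ha : a ∈ localAlg N Λ) : translate N x a ∈ localAlg N (shiftFinset Λ x) := by
  obtain ⟨M, rfl⟩ := ha
  let e : LocConfig N (shiftFinset Λ x) ≃ LocConfig N Λ :=
    { toFun := fun η y => η ⟨y.1 + x, Finset.mem_image_of_mem _ y.2⟩
      invFun := fun η y => η ⟨y.1 - x, by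
        obtain ⟨z, hz, h⟩ := Finset.mem_image.1 y.2
        rw [← h]; simpa using hz⟩
      left_inv := fun η => by funext y; simp
      right_inv := fun η => by funext y; simp }
  refine ⟨Matrix.of fun ζ η => M (e ζ) (e η), ?_⟩
  ext ψ σ
  change localOp _ ψ σ = localOp M ((permUnitary (shift N x)).symm ψ) (shift N x σ)
  rw [localOp_apply, localOp_apply, ← e.sum_comp]
  refine Finset.sum_congr rfl fun η _ => ?_
  change _ = M (e (restr _ σ)) (e η) * ψ ((shift N x).symm (merge (shift N x σ) (e η)))
  congr 1
  refine congrArg (fun τ => ψ τ) (funext fun y => ?_)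
  have hy : y - x ∈ Λ ↔ y ∈ shiftFinset Λ x := by
    simp only [shiftFinset, Finset.mem_image]
    exact ⟨fun h => ⟨_, h, by ring⟩, by rintro ⟨z, hz, rfl⟩; simpa using hz⟩
  by_cases h : y ∈ shiftFinset Λ x
  · simp [shift, merge, h, hy.2 h, e]
  · simp [shift, merge, h, hy]

/-! ### Exponentially localized elements -/

/-- `F_x(A) = sup_{0 ≠ a ∈ 𝒜({0})} ‖[A, τ_x(a)]‖ / ‖a‖`. The family is bounded by `2 ‖A‖`. -/
def commStrength {N : ℕ} (x : ℤ) (A : Op N) : ℝ :=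
  ⨆ a : {a : Op N // a ∈ localAlg N {0} ∧ a ≠ 0},
    ‖A * translate N x a.1 - translate N x a.1 * A‖ / ‖a.1‖

/-- The set `𝒜_exp` of exponentially localized elements of the quasi-local algebra. -/
def expLocal (N : ℕ) : Set (quasiLocal N) :=
  {A | ∃ μ : ℝ, 0 < μ ∧ Filter.Tendsto
    (fun x : ℤ => Real.exp (μ * |(x : ℝ)|) * commStrength x (A : Op N))
    Filter.cofinite (nhds 0)}

/-! ### Potentials and local dynamics -/

/-- A translation invariant potential: a self-adjoint `Φ(X) ∈ 𝒜(X)` for each finite `X ⊂ ℤ`, with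
`τ_x(Φ(X)) = Φ(X + x)`. -/
structure IsPotential {N : ℕ} (Φ : Finset ℤ → Op N) : Prop where
  mem_localAlg : ∀ X, Φ X ∈ localAlg N X
  isSelfAdjoint : ∀ X, IsSelfAdjoint (Φ X)
  translate_eq : ∀ x X, translate N x (Φ X) = Φ (shiftFinset X x)

/-- Finiteness of `‖Φ‖_r = ∑_{X ∋ 0} |X| (N+1)^(2|X|) e^(r D(X)) ‖Φ(X)‖`, where `D(X)` is the
diameter of `X`. -/
def FiniteNorm {N : ℕ} (Φ : Finset ℤ → Op N) (r : ℝ) : Prop :=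
  Summable fun X : {X : Finset ℤ // (0 : ℤ) ∈ X} =>
    (X.1.card : ℝ) * ((N : ℝ) + 1) ^ (2 * X.1.card)
      * Real.exp (r * Metric.diam (X.1 : Set ℤ)) * ‖Φ X.1‖

/-- The local Hamiltonian `H_Λ = ∑_{V ⊆ Λ} Φ(V)`. -/
def hamiltonian {N : ℕ} (Φ : Finset ℤ → Op N) (Λ : Finset ℤ) : Op N := ∑ V ∈ Λ.powerset, Φ V

/-- The local dynamics `A ↦ e^(i t H_Λ) A e^(-i t H_Λ)`. -/
def localDynamics {N : ℕ} (Φ : Finset ℤ → Op N) (Λ : Finset ℤ) (t : ℝ) (A : Op N) : Op N :=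
  NormedSpace.exp ((Complex.I * (t : ℂ)) • hamiltonian Φ Λ) * A
    * NormedSpace.exp (-((Complex.I * (t : ℂ)) • hamiltonian Φ Λ))

end SpinChain

end

/-! The heart is a Lieb–Robinson type bound in the form `ExpBound μ C A`: `F_y(A) ≤ C e^(-μ|y|)` for
every site `y`. Such a bound survives the local dynamics for `|t| ≤ T`, with `C` replaced by `G C`
and `G` independent of the region `Λ` (`exists_expBound_localDynamics_uniform`).

For `b` at the site `x`, Duhamel's formula bounds `‖[α_t(A), b]‖` by `‖[A, b]‖` plus `|t|` times the
supremum over `|s| ≤ |t|` of `‖[α_s(A), [H_Λ, b]]‖`. Only the `Φ(X)` with `x ∈ X` contribute.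
Expanding `[Φ(X), b]` in products of one-site matrix units reduces its commutator with `α_s(A)` to
the `F_y(α_s(A))`, `y ∈ X`, at the cost of `(N+1)^(2|X|)`; passing from `e^(-μ|y|)` to `e^(-μ|x|)`
costs `e^(μ D(X))`. These are the weights in `‖Φ‖_μ`. For short times a bound `S` for all `α_s(A)`
thus improves to `C + S/2`. As `Λ` is finite, some bound exists; iterating the improvement leaves
`2C`, whatever the first bound was. Longer times follow from the group law.

The limit exists because the local dynamics of two regions differ by commutators of `α_s(A)` with
the extra `Φ(X)`, which the uniform bound makes summable (`cauchySeq_localDynamics_of_expBound`);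
density and isometry give all of the quasi-local algebra. Since `ExpBound` is closed under norm
limits, `α_t` maps `𝒜_exp` into itself, and `α_(-t)` gives equality. -/

noncomputable section

namespace SpinChain

/-! ### Inner dynamics of a C*-algebra -/

section Heisenberg

open NormedSpace

variable {𝔄 : Type*} [CStarAlgebra 𝔄]

/-- The inner dynamics `A ↦ e^(itH) A e^(-itH)`. -/
def heisenberg (H : 𝔄) (t : ℝ) (A : 𝔄) : 𝔄 :=
  exp ((Complex.I * (t : ℂ)) • H) * A * exp (-((Complex.I * (t : ℂ)) • H))

theorem exp_mul_I_smul_add (H : 𝔄) (s t : ℝ) :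
    exp ((Complex.I * ((s + t : ℝ) : ℂ)) • H)
      = exp ((Complex.I * (s : ℂ)) • H) * exp ((Complex.I * (t : ℂ)) • H) := by
  let +nondep : NormedAlgebra ℚ 𝔄 := .restrictScalars ℚ ℂ 𝔄
  rw [← exp_add_of_commute ((Commute.refl H).smul_left _ |>.smul_right _), ← add_smul]
  push_cast
  rw [mul_add]

theorem exp_mul_exp_neg (K : 𝔄) : exp K * exp (-K) = 1 := by
  let +nondep : NormedAlgebra ℚ 𝔄 := .restrictScalars ℚ ℂ 𝔄
  rw [← exp_add_of_commute (Commute.refl K).neg_right]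
  simp

theorem exp_neg_mul_exp (K : 𝔄) : exp (-K) * exp K = 1 := by
  let +nondep : NormedAlgebra ℚ 𝔄 := .restrictScalars ℚ ℂ 𝔄
  rw [← exp_add_of_commute (Commute.refl K).neg_left]
  simp

theorem heisenberg_zero_time (H A : 𝔄) : heisenberg H 0 A = A := by
  simp [heisenberg]

theorem heisenberg_add_time (H : 𝔄) (s t : ℝ) (A : 𝔄) :
    heisenberg H (s + t) A = heisenberg H s (heisenberg H t A) := by
  have h : -((Complex.I * ((s + t : ℝ) : ℂ)) • H) = (Complex.I * ((-t + -s : ℝ) : ℂ)) • H := by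
    push_cast
    rw [← neg_smul]
    ring_nf
  have hn (t : ℝ) : -((Complex.I * (t : ℂ)) • H) = (Complex.I * ((-t : ℝ) : ℂ)) • H := by
    push_cast
    rw [← neg_smul]
    ring_nf
  rw [heisenberg, h, exp_mul_I_smul_add, exp_mul_I_smul_add, heisenberg, heisenberg, hn, hn]
  simp only [mul_assoc]

theorem heisenberg_neg_time (H : 𝔄) (t : ℝ) (A : 𝔄) :
    heisenberg H (-t) (heisenberg H t A) = A := by
  rw [← heisenberg_add_time, neg_add_cancel, heisenberg_zero_time]

theorem heisenberg_add (H : 𝔄) (t : ℝ) (A B : 𝔄) :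
    heisenberg H t (A + B) = heisenberg H t A + heisenberg H t B := by
  simp [heisenberg, mul_add, add_mul]

theorem heisenberg_sub (H : 𝔄) (t : ℝ) (A B : 𝔄) :
    heisenberg H t (A - B) = heisenberg H t A - heisenberg H t B := by
  simp [heisenberg, mul_sub, sub_mul]

theorem heisenberg_smul (H : 𝔄) (t : ℝ) (c : ℂ) (A : 𝔄) :
    heisenberg H t (c • A) = c • heisenberg H t A := by
  simp [heisenberg]

theorem heisenberg_mul (H : 𝔄) (t : ℝ) (A B : 𝔄) :
    heisenberg H t (A * B) = heisenberg H t A * heisenberg H t B := by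
  simp only [heisenberg]
  calc _ = exp ((Complex.I * (t : ℂ)) • H) * A * 1 * B * exp (-((Complex.I * (t : ℂ)) • H)) := by
        simp only [mul_assoc, mul_one]
    _ = _ := by
        rw [← exp_neg_mul_exp ((Complex.I * (t : ℂ)) • H)]
        simp only [mul_assoc]

theorem mul_I_smul_mem_skewAdjoint {H : 𝔄} (hH : IsSelfAdjoint H) (t : ℝ) :
    (Complex.I * (t : ℂ)) • H ∈ skewAdjoint 𝔄 := by
  rw [skewAdjoint.mem_iff, star_smul, hH.star_eq, ← neg_smul]
  simp

theorem heisenberg_star {H : 𝔄} (hH : IsSelfAdjoint H) (t : ℝ) (A : 𝔄) :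
    heisenberg H t (star A) = star (heisenberg H t A) := by
  have h := skewAdjoint.mem_iff.1 (mul_I_smul_mem_skewAdjoint hH t)
  simp only [heisenberg, star_mul, star_exp, star_neg, h, neg_neg, mul_assoc]

theorem heisenberg_commutator (H : 𝔄) (t : ℝ) (A B : 𝔄) :
    heisenberg H t (A * B - B * A)
      = heisenberg H t A * heisenberg H t B - heisenberg H t B * heisenberg H t A := by
  rw [heisenberg_sub, heisenberg_mul, heisenberg_mul]

theorem norm_heisenberg {H : 𝔄} (hH : IsSelfAdjoint H) (t : ℝ) (A : 𝔄) :
    ‖heisenberg H t A‖ = ‖A‖ := by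
  let +nondep : NormedAlgebra ℚ 𝔄 := .restrictScalars ℚ ℂ 𝔄
  have h := mul_I_smul_mem_skewAdjoint hH t
  have h1 := exp_mem_unitary_of_mem_skewAdjoint h
  have h2 := exp_mem_unitary_of_mem_skewAdjoint ((skewAdjoint 𝔄).neg_mem h)
  rw [heisenberg, CStarRing.norm_mul_mem_unitary _ h2, CStarRing.norm_mem_unitary_mul _ h1]

theorem heisenberg_eq_self_of_commute {H A : 𝔄} (h : Commute H A) (t : ℝ) :
    heisenberg H t A = A := by
  have h1 : Commute (exp ((Complex.I * (t : ℂ)) • H)) A := (h.smul_left _).exp_left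
  rw [heisenberg, h1.eq, mul_assoc, exp_mul_exp_neg, mul_one]

theorem norm_commutator_heisenberg {H : 𝔄} (hH : IsSelfAdjoint H) (t : ℝ) (A B : 𝔄) :
    ‖heisenberg H t A * B - B * heisenberg H t A‖
      = ‖A * heisenberg H (-t) B - heisenberg H (-t) B * A‖ := by
  rw [← norm_heisenberg hH (-t), heisenberg_commutator, heisenberg_neg_time]

theorem hasDerivAt_exp_mul_I_smul (H : 𝔄) (t : ℝ) :
    HasDerivAt (fun t : ℝ => exp ((Complex.I * (t : ℂ)) • H))
      (exp ((Complex.I * (t : ℂ)) • H) * (Complex.I • H)) t := by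
  have e (t : ℝ) : (Complex.I * (t : ℂ)) • H = t • (Complex.I • H) := by
    rw [mul_comm, mul_smul, Complex.coe_smul]
  simpa only [e] using hasDerivAt_exp_smul_const (𝕂 := ℝ) (Complex.I • H) t

theorem hasDerivAt_exp_neg_mul_I_smul (H : 𝔄) (t : ℝ) :
    HasDerivAt (fun t : ℝ => exp (-((Complex.I * (t : ℂ)) • H)))
      (-((Complex.I • H) * exp (-((Complex.I * (t : ℂ)) • H)))) t := by
  have e (t : ℝ) : -((Complex.I * (t : ℂ)) • H) = t • -(Complex.I • H) := by
    rw [mul_comm, mul_smul, Complex.coe_smul, smul_neg]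
  simpa only [e, neg_mul] using hasDerivAt_exp_smul_const' (𝕂 := ℝ) (-(Complex.I • H)) t

theorem hasDerivAt_heisenberg (H A : 𝔄) (t : ℝ) :
    HasDerivAt (fun t => heisenberg H t A)
      (heisenberg H t (Complex.I • (H * A - A * H))) t := by
  have h := ((hasDerivAt_exp_mul_I_smul H t).mul_const A).mul (hasDerivAt_exp_neg_mul_I_smul H t)
  refine h.congr_deriv ?_
  simp only [heisenberg, mul_neg, smul_sub, mul_sub, sub_mul, smul_mul_assoc, mul_smul_comm,
    mul_assoc]
  rw [sub_eq_add_neg]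

theorem norm_sub_le_of_hasDerivAt {E : Type*} [NormedAddCommGroup E] [NormedSpace ℝ E]
    {f f' : ℝ → E} (hf : ∀ s, HasDerivAt f (f' s) s) {t C : ℝ}
    (hC : ∀ s, |s| ≤ |t| → ‖f' s‖ ≤ C) : ‖f t - f 0‖ ≤ |t| * C := by
  have h := (convex_Icc (-|t|) |t|).norm_image_sub_le_of_norm_hasDerivWithin_le
    (fun s _ => (hf s).hasDerivWithinAt) (fun s hs => hC s (abs_le.2 hs))
    (x := 0) (y := t) ⟨by simp, by simp⟩ (abs_le.1 le_rfl)
  rwa [sub_zero, Real.norm_eq_abs, mul_comm] at h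

/-- The growth of commutators under an inner dynamics. -/
theorem norm_commutator_heisenberg_le {H : 𝔄} (hH : IsSelfAdjoint H) (A B : 𝔄) {t C : ℝ}
    (hC : ∀ s, |s| ≤ |t| → ‖heisenberg H s A * (H * B - B * H)
      - (H * B - B * H) * heisenberg H s A‖ ≤ C) :
    ‖heisenberg H t A * B - B * heisenberg H t A‖ ≤ ‖A * B - B * A‖ + |t| * C := by
  have hd (s : ℝ) : HasDerivAt (fun s => A * heisenberg H s B - heisenberg H s B * A)
      (A * heisenberg H s (Complex.I • (H * B - B * H))
        - heisenberg H s (Complex.I • (H * B - B * H)) * A) s :=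
    ((hasDerivAt_heisenberg H B s).const_mul A).sub ((hasDerivAt_heisenberg H B s).mul_const A)
  -- The evolution is moved onto `B`, so that differentiation produces `[H, B]`; this reverses the
  -- sign of time.
  have h := norm_sub_le_of_hasDerivAt hd (t := -t) (C := C) (by
    intro s hs
    rw [heisenberg_smul, mul_smul_comm, smul_mul_assoc, ← smul_sub, norm_smul, Complex.norm_I,
      one_mul]
    have h1 := hC (-s) (by simpa using hs)
    rwa [norm_commutator_heisenberg hH, neg_neg] at h1)
  rw [norm_commutator_heisenberg hH]
  rw [heisenberg_zero_time, abs_neg] at h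
  calc _ = ‖(A * B - B * A) + (A * heisenberg H (-t) B - heisenberg H (-t) B * A
        - (A * B - B * A))‖ := by congr 1; abel
    _ ≤ _ := (norm_add_le _ _).trans (add_le_add_right h _)

/-- Comparison of two inner dynamics. -/
theorem norm_heisenberg_sub_le {H K : 𝔄} (hK : IsSelfAdjoint K) (A : 𝔄)
    {t C : ℝ} (hC : ∀ s, |s| ≤ |t| →
      ‖heisenberg H s A * (K - H) - (K - H) * heisenberg H s A‖ ≤ C) :
    ‖heisenberg K t A - heisenberg H t A‖ ≤ |t| * C := by
  let V : ℝ → 𝔄 := fun s => exp (-((Complex.I * (s : ℂ)) • K))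
  let W : ℝ → 𝔄 := fun s => exp ((Complex.I * (s : ℂ)) • K)
  have hn (s : ℝ) (B : 𝔄) : V s * B * W s = heisenberg K (-s) B := by simp [heisenberg, V, W]
  -- Undoing the `K`-evolution after the `H`-evolution gives a curve that is constant when `H = K`;
  -- its velocity involves only `K - H` and the `H`-evolved observable.
  have hd (s : ℝ) : HasDerivAt (fun s => V s * heisenberg H s A * W s)
      (V s * (Complex.I • (heisenberg H s A * (K - H) - (K - H) * heisenberg H s A)) * W s) s := by
    have h := ((hasDerivAt_exp_neg_mul_I_smul K s).mul (hasDerivAt_heisenberg H A s)).mul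
      (hasDerivAt_exp_mul_I_smul K s)
    refine h.congr_deriv ?_
    have h1 : Commute (Complex.I • K) (V s) :=
      ((Commute.refl K).smul_left _ |>.smul_right _).neg_right.exp_right
    have h2 : Commute (Complex.I • K) (W s) :=
      ((Commute.refl K).smul_left _ |>.smul_right _).exp_right
    have h3 : heisenberg H s H = H := heisenberg_eq_self_of_commute (Commute.refl H) s
    change (-((Complex.I • K) * V s) * heisenberg H s A
        + V s * heisenberg H s (Complex.I • (H * A - A * H))) * W s
        + V s * heisenberg H s A * (W s * (Complex.I • K)) = _
    rw [h1.eq, ← h2.eq, heisenberg_smul, heisenberg_commutator, h3]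
    simp only [smul_sub, mul_sub, sub_mul, smul_mul_assoc, mul_smul_comm, mul_assoc, neg_mul,
      add_mul]
    abel
  have h := norm_sub_le_of_hasDerivAt hd (t := t) (C := C) (by
    intro s hs
    rw [hn, norm_heisenberg hK, norm_smul, Complex.norm_I, one_mul]
    exact hC s hs)
  rw [hn, hn, heisenberg_zero_time, neg_zero, heisenberg_zero_time, norm_sub_rev] at h
  rw [← norm_heisenberg hK (-t), heisenberg_sub, heisenberg_neg_time]
  exact h

theorem heisenberg_mem (S : StarSubalgebra ℂ 𝔄) (hS : IsClosed (S : Set 𝔄)) {H A : 𝔄}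
    (hH : H ∈ S) (hA : A ∈ S) (t : ℝ) : heisenberg H t A ∈ S := by
  let +nondep : NormedAlgebra ℚ 𝔄 := .restrictScalars ℚ ℂ 𝔄
  have h1 (c : ℂ) : exp (c • H) ∈ S := exp_mem (R := ℂ) hS (S.smul_mem hH c)
  rw [heisenberg, ← neg_smul]
  exact S.mul_mem (S.mul_mem (h1 _) hA) (h1 _)

end Heisenberg

/-! ### Commutators with local observables -/

theorem localDynamics_eq_heisenberg {N : ℕ} (Φ : Finset ℤ → Op N) (Λ : Finset ℤ) (t : ℝ)
    (A : Op N) : localDynamics Φ Λ t A = heisenberg (hamiltonian Φ Λ) t A := rfl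

theorem merge_comm {N : ℕ} {Λ Λ' : Finset ℤ} (h : Disjoint Λ Λ') (σ : Config N)
    (η : LocConfig N Λ) (η' : LocConfig N Λ') :
    merge (merge σ η) η' = merge (merge σ η') η := by
  funext x
  by_cases hx : x ∈ Λ
  · have hx' := Finset.disjoint_left.1 h hx
    simp [merge, hx, hx']
  · simp [merge, hx]

theorem restr_merge_of_disjoint {N : ℕ} {Λ Λ' : Finset ℤ} (h : Disjoint Λ Λ') (σ : Config N)
    (η : LocConfig N Λ) : restr Λ' (merge σ η) = restr Λ' σ := by
  funext x
  have hx := Finset.disjoint_right.1 h x.2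
  simp [restr, merge, hx]

theorem commute_of_mem_localAlg {N : ℕ} {Λ Λ' : Finset ℤ} (h : Disjoint Λ Λ') {a b : Op N}
    (ha : a ∈ localAlg N Λ) (hb : b ∈ localAlg N Λ') : Commute a b := by
  obtain ⟨M, rfl⟩ := ha
  obtain ⟨M', rfl⟩ := hb
  change localOp M * localOp M' = localOp M' * localOp M
  ext ψ σ
  simp only [mul_apply_eq_comp, localOp_apply, Finset.mul_sum,
    restr_merge_of_disjoint h, restr_merge_of_disjoint h.symm]
  rw [Finset.sum_comm]
  refine Finset.sum_congr rfl fun η' _ => Finset.sum_congr rfl fun η _ => ?_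
  rw [merge_comm h]
  ring

theorem mem_quasiLocal_of_mem_localAlg {N : ℕ} {Λ : Finset ℤ} {a : Op N}
    (ha : a ∈ localAlg N Λ) : a ∈ quasiLocal N := by
  have h : a ∈ (quasiLocal N : Set (Op N)) := by
    rw [coe_quasiLocal]
    exact subset_closure (Set.mem_iUnion.2 ⟨Λ, ha⟩)
  exact h

theorem isClosed_quasiLocal (N : ℕ) : IsClosed (quasiLocal N : Set (Op N)) := by
  rw [coe_quasiLocal]
  exact isClosed_closure

theorem norm_translate {N : ℕ} (x : ℤ) (a : Op N) : ‖translate N x a‖ = ‖a‖ :=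
  StarAlgEquiv.norm_map (translate N x) a

theorem translate_translate_neg {N : ℕ} (x : ℤ) (a : Op N) :
    translate N x (translate N (-x) a) = a := by
  have h (y : ℤ) (ψ : Hil N) (σ : Config N) :
      permUnitary (shift N y) ψ σ = ψ (fun z => σ (z + y)) := rfl
  have h' (y : ℤ) (ψ : Hil N) (σ : Config N) :
      (permUnitary (shift N y)).symm ψ σ = ψ (fun z => σ (z - y)) := rfl
  have e (ψ : Hil N) : (permUnitary (shift N (-x))).symm ((permUnitary (shift N x)).symm ψ) = ψ := by
    ext σ
    rw [h', h']
    simp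
  ext ψ σ
  change permUnitary (shift N x) (permUnitary (shift N (-x)) (a
    ((permUnitary (shift N (-x))).symm ((permUnitary (shift N x)).symm ψ)))) σ = a ψ σ
  rw [e, h, h]
  simp

theorem translate_neg_mem {N : ℕ} {x : ℤ} {b : Op N} (hb : b ∈ localAlg N {x}) :
    translate N (-x) b ∈ localAlg N {0} := by
  simpa [shiftFinset] using map_translate_localAlg_le N (-x) {x} b hb

theorem translate_mem_singleton {N : ℕ} (x : ℤ) {a : Op N} (ha : a ∈ localAlg N {0}) :
    translate N x a ∈ localAlg N {x} := by
  simpa [shiftFinset] using map_translate_localAlg_le N x {0} a ha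

theorem norm_commutator_le_two {R : Type*} [NormedRing R] (A B : R) :
    ‖A * B - B * A‖ ≤ 2 * ‖A‖ * ‖B‖ := by
  calc _ ≤ ‖A * B‖ + ‖B * A‖ := norm_sub_le _ _
    _ ≤ ‖A‖ * ‖B‖ + ‖B‖ * ‖A‖ := add_le_add (norm_mul_le _ _) (norm_mul_le _ _)
    _ = _ := by ring

/-! ### The one-site commutator strength `F_x` -/

theorem commStrength_bddAbove {N : ℕ} (x : ℤ) (A : Op N) :
    BddAbove (Set.range fun a : {a : Op N // a ∈ localAlg N {0} ∧ a ≠ 0} =>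
      ‖A * translate N x a.1 - translate N x a.1 * A‖ / ‖a.1‖) := by
  refine ⟨2 * ‖A‖, ?_⟩
  rintro _ ⟨a, rfl⟩
  have h := norm_commutator_le_two A (translate N x a.1)
  rw [norm_translate] at h
  exact div_le_of_le_mul₀ (norm_nonneg _) (by positivity) h

theorem commStrength_nonneg {N : ℕ} (x : ℤ) (A : Op N) : 0 ≤ commStrength x A :=
  Real.iSup_nonneg fun _ => by positivity

/-- Every `b ∈ 𝒜({x})` is `τ_x` of an element of `𝒜({0})` of the same norm. Together with
`commStrength_le` this replaces the supremum by a bound at the site `x`. -/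
theorem norm_commutator_le {N : ℕ} {x : ℤ} (A : Op N) {b : Op N} (hb : b ∈ localAlg N {x}) :
    ‖A * b - b * A‖ ≤ commStrength x A * ‖b‖ := by
  rcases eq_or_ne b 0 with rfl | hb0
  · simp
  have h0 : translate N (-x) b ≠ 0 := by
    rw [← norm_ne_zero_iff, norm_translate]
    exact norm_ne_zero_iff.2 hb0
  have h := le_ciSup (commStrength_bddAbove x A) ⟨translate N (-x) b, translate_neg_mem hb, h0⟩
  simp only [translate_translate_neg, norm_translate] at h
  exact (div_le_iff₀ (norm_pos_iff.2 hb0)).1 h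

theorem commStrength_le {N : ℕ} {x : ℤ} {A : Op N} {C : ℝ} (hC : 0 ≤ C)
    (h : ∀ b ∈ localAlg N {x}, ‖A * b - b * A‖ ≤ C * ‖b‖) : commStrength x A ≤ C := by
  refine Real.iSup_le (fun a => ?_) hC
  have h1 := h _ (translate_mem_singleton x a.2.1)
  rw [norm_translate] at h1
  exact div_le_of_le_mul₀ (norm_nonneg _) hC h1

theorem commStrength_le_two_mul_norm {N : ℕ} (x : ℤ) (A : Op N) :
    commStrength x A ≤ 2 * ‖A‖ :=
  commStrength_le (by positivity) fun b _ => norm_commutator_le_two A b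

theorem commStrength_eq_zero_of_forall_commute {N : ℕ} {x : ℤ} {A : Op N}
    (h : ∀ b ∈ localAlg N {x}, Commute A b) : commStrength x A = 0 :=
  le_antisymm (commStrength_le le_rfl fun b hb => by simp [(h b hb).eq]) (commStrength_nonneg x A)

theorem commStrength_eq_zero_of_mem_localAlg {N : ℕ} {Λ : Finset ℤ} {A : Op N}
    (hA : A ∈ localAlg N Λ) {x : ℤ} (hx : x ∉ Λ) : commStrength x A = 0 :=
  commStrength_eq_zero_of_forall_commute fun _ hb =>
    commute_of_mem_localAlg (Finset.disjoint_singleton_right.2 hx) hA hb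

theorem commStrength_add_le {N : ℕ} (x : ℤ) (A B : Op N) :
    commStrength x (A + B) ≤ commStrength x A + commStrength x B := by
  refine commStrength_le (add_nonneg (commStrength_nonneg x A) (commStrength_nonneg x B))
    fun b hb => ?_
  calc ‖(A + B) * b - b * (A + B)‖ = ‖(A * b - b * A) + (B * b - b * B)‖ := by
        congr 1; noncomm_ring
    _ ≤ ‖A * b - b * A‖ + ‖B * b - b * B‖ := norm_add_le _ _
    _ ≤ commStrength x A * ‖b‖ + commStrength x B * ‖b‖ :=
        add_le_add (norm_commutator_le A hb) (norm_commutator_le B hb)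
    _ = _ := by ring

theorem commStrength_mul_le {N : ℕ} (x : ℤ) (A B : Op N) :
    commStrength x (A * B) ≤ ‖A‖ * commStrength x B + ‖B‖ * commStrength x A := by
  have hA := commStrength_nonneg x A
  have hB := commStrength_nonneg x B
  refine commStrength_le (by positivity) fun b hb => ?_
  calc ‖(A * B) * b - b * (A * B)‖ = ‖A * (B * b - b * B) + (A * b - b * A) * B‖ := by
        congr 1; noncomm_ring
    _ ≤ ‖A‖ * ‖B * b - b * B‖ + ‖A * b - b * A‖ * ‖B‖ :=
        (norm_add_le _ _).trans (add_le_add (norm_mul_le _ _) (norm_mul_le _ _))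
    _ ≤ ‖A‖ * (commStrength x B * ‖b‖) + (commStrength x A * ‖b‖) * ‖B‖ := by
        gcongr <;> exact norm_commutator_le _ hb
    _ = _ := by ring

theorem commStrength_star_le {N : ℕ} (x : ℤ) (A : Op N) :
    commStrength x (star A) ≤ commStrength x A := by
  refine commStrength_le (commStrength_nonneg x A) fun b hb => ?_
  rw [← norm_star b, ← norm_star]
  have h := norm_commutator_le A (star_mem hb)
  rw [norm_sub_rev] at h
  simpa using h

/-- The matrix unit with entries labelled by configurations of the whole chain. -/
def configUnit {N : ℕ} (X : Finset ℤ) (ζ η : Config N) : Op N :=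
  matrixUnit (restr X ζ) (restr X η)

theorem norm_matrixUnit_le {N : ℕ} {Λ : Finset ℤ} (ζ η : LocConfig N Λ) :
    ‖matrixUnit ζ η‖ ≤ 1 :=
  LinearMap.mkContinuous_norm_le _ zero_le_one _

theorem matrixUnit_mem_localAlg {N : ℕ} {Λ : Finset ℤ} (ζ η : LocConfig N Λ) :
    matrixUnit ζ η ∈ localAlg N Λ := by
  refine ⟨Matrix.of fun ζ' η' => if ζ' = ζ ∧ η' = η then 1 else 0, ?_⟩
  ext ψ σ
  change localOp _ ψ σ = _
  rw [localOp_apply, matrixUnit_apply]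
  by_cases h : restr Λ σ = ζ <;> simp [h]

theorem configUnit_empty {N : ℕ} (ζ η : Config N) : configUnit ∅ ζ η = 1 := by
  ext ψ σ
  have h1 : restr ∅ σ = restr ∅ ζ := Subsingleton.elim _ _
  have h2 : merge σ (restr ∅ η) = σ := by funext x; simp [merge]
  simp [configUnit, h1, h2]

/-- Matrix units are tensor products of one-site matrix units. Labels on the whole chain let the
same `ζ`, `η` serve all regions. -/
theorem configUnit_insert {N : ℕ} {X : Finset ℤ} {y : ℤ} (hy : y ∉ X) (ζ η : Config N) :
    configUnit (insert y X) ζ η = configUnit {y} ζ η * configUnit X ζ η := by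
  have hd : Disjoint {y} X := Finset.disjoint_singleton_left.2 hy
  ext ψ σ
  have h1 : restr (insert y X) σ = restr (insert y X) ζ ↔
      restr {y} σ = restr {y} ζ ∧ restr X σ = restr X ζ := by
    simp [restr, funext_iff]
  have h2 : merge σ (restr (insert y X) η) = merge (merge σ (restr {y} η)) (restr X η) := by
    funext x
    by_cases hx : x ∈ X
    · simp [merge, restr, hx]
    · by_cases hxy : x = y <;> simp [merge, restr, hx, hxy]
  simp only [configUnit, matrixUnit_apply, mul_apply_eq_comp, h1, h2,
    restr_merge_of_disjoint hd, ite_and]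

/-- Leibniz rule along the product over the sites of `X`, all factors having norm at most one. -/
theorem norm_commutator_configUnit_le {N : ℕ} (B : Op N) (X : Finset ℤ) (ζ η : Config N) :
    ‖B * configUnit X ζ η - configUnit X ζ η * B‖ ≤ ∑ y ∈ X, commStrength y B := by
  induction X using Finset.induction_on with
  | empty => simp [configUnit_empty]
  | insert y X hy ih =>
    rw [configUnit_insert hy, Finset.sum_insert hy]
    set e := configUnit {y} ζ η
    set f := configUnit X ζ η
    have he : ‖e‖ ≤ 1 := norm_matrixUnit_le _ _
    have hf : ‖f‖ ≤ 1 := norm_matrixUnit_le _ _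
    have h := norm_commutator_le B (b := e) (matrixUnit_mem_localAlg _ _)
    calc ‖B * (e * f) - e * f * B‖ = ‖(B * e - e * B) * f + e * (B * f - f * B)‖ := by
          congr 1; noncomm_ring
      _ ≤ ‖B * e - e * B‖ * ‖f‖ + ‖e‖ * ‖B * f - f * B‖ :=
          (norm_add_le _ _).trans (add_le_add (norm_mul_le _ _) (norm_mul_le _ _))
      _ ≤ ‖B * e - e * B‖ * 1 + 1 * ‖B * f - f * B‖ := by gcongr
      _ ≤ commStrength y B + ∑ y ∈ X, commStrength y B := by
          rw [mul_one, one_mul]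
          refine add_le_add (h.trans ?_) ih
          exact mul_le_of_le_one_right (commStrength_nonneg y B) he

theorem norm_entry_le {N : ℕ} {Λ : Finset ℤ} (M : Matrix (LocConfig N Λ) (LocConfig N Λ) ℂ)
    (ζ η : LocConfig N Λ) : ‖M ζ η‖ ≤ ‖localOp M‖ := by
  classical
  let σ : Config N := merge (fun _ => 0) ζ
  -- The entry is one coordinate of the image of a basis vector.
  let ψ : Hil N := lp.single 2 (merge σ η) (1 : ℂ)
  have h1 : localOp M ψ σ = M ζ η := by
    rw [localOp_apply, Finset.sum_eq_single η]
    · simp [ψ, σ]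
    · intro η' _ hne
      have : merge σ η' ≠ merge σ η := fun h => hne (by
        simpa using congrArg (restr Λ) h)
      simp only [ψ, lp.single_apply_ne _ _ _ this, mul_zero]
    · simp
  have h2 : ‖ψ‖ = 1 := by simp [ψ, lp.norm_single]
  rw [← h1]
  calc _ ≤ ‖localOp M ψ‖ := lp.norm_apply_le_norm (by norm_num) _ _
    _ ≤ ‖localOp M‖ * ‖ψ‖ := (localOp M).le_opNorm ψ
    _ = _ := by rw [h2, mul_one]

/-- The commutator with an observable of the region `X` is controlled by the commutators with the
observables of the sites of `X`. -/
theorem norm_commutator_le_sum {N : ℕ} (B : Op N) {X : Finset ℤ} {c : Op N}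
    (hc : c ∈ localAlg N X) :
    ‖B * c - c * B‖ ≤ ((N : ℝ) + 1) ^ (2 * X.card) * ‖c‖ * ∑ y ∈ X, commStrength y B := by
  obtain ⟨M, rfl⟩ := hc
  change ‖B * localOp M - localOp M * B‖ ≤ _ * ‖localOp M‖ * _
  set S := ∑ y ∈ X, commStrength y B
  have hterm (ζ η : LocConfig N X) :
      ‖M ζ η • (B * matrixUnit ζ η - matrixUnit ζ η * B)‖ ≤ ‖localOp M‖ * S := by
    have h := norm_commutator_configUnit_le B X (merge (fun _ => 0) ζ) (merge (fun _ => 0) η)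
    simp only [configUnit, restr_merge] at h
    rw [norm_smul]
    gcongr
    exact norm_entry_le M ζ η
  -- Each of the two sums over labels has this many terms, whence the exponent `2|X|`.
  have hcard : (Fintype.card (LocConfig N X) : ℝ) = ((N : ℝ) + 1) ^ X.card := by
    simp [LocConfig]
  calc ‖B * localOp M - localOp M * B‖
      = ‖∑ ζ, ∑ η, M ζ η • (B * matrixUnit ζ η - matrixUnit ζ η * B)‖ := by
        simp only [localOp, Finset.mul_sum, Finset.sum_mul, smul_sub, Finset.sum_sub_distrib,
          mul_smul_comm, smul_mul_assoc]
    _ ≤ ∑ _ζ : LocConfig N X, ∑ _η : LocConfig N X, ‖localOp M‖ * S :=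
        (norm_sum_le _ _).trans (Finset.sum_le_sum fun ζ _ =>
          (norm_sum_le _ _).trans (Finset.sum_le_sum fun η _ => hterm ζ η))
    _ = _ := by
        simp only [Finset.sum_const, Finset.card_univ, nsmul_eq_mul, hcard]
        ring

/-! ### Propagation of exponential localization under the local dynamics -/

/-- The summand `|X| (N+1)^(2|X|) e^(μ D(X)) ‖Φ(X)‖` of the norm of a potential. -/
def potWeight {N : ℕ} (Φ : Finset ℤ → Op N) (μ : ℝ) (X : Finset ℤ) : ℝ :=
  (X.card : ℝ) * ((N : ℝ) + 1) ^ (2 * X.card) * Real.exp (μ * Metric.diam (X : Set ℤ)) * ‖Φ X‖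

/-- The norm `∑_{X ∋ 0} |X| (N+1)^(2|X|) e^(μ D(X)) ‖Φ(X)‖` of a potential. -/
def potNorm {N : ℕ} (Φ : Finset ℤ → Op N) (μ : ℝ) : ℝ :=
  ∑' X : {X : Finset ℤ // (0 : ℤ) ∈ X}, potWeight Φ μ X.1

/-- `F_y(A) ≤ C e^(-μ|y|)` for all sites `y`. -/
def ExpBound {N : ℕ} (μ C : ℝ) (A : Op N) : Prop :=
  ∀ y : ℤ, commStrength y A ≤ C * Real.exp (-(μ * |(y : ℝ)|))

section

variable {N : ℕ} {Φ : Finset ℤ → Op N} {μ : ℝ}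

/-! ### Weights of a potential and local Hamiltonians -/

theorem ExpBound.nonneg {C : ℝ} {A : Op N} (h : ExpBound μ C A) : 0 ≤ C := by
  simpa using (commStrength_nonneg 0 A).trans (h 0)

theorem potWeight_nonneg (Φ : Finset ℤ → Op N) (μ : ℝ) (X : Finset ℤ) : 0 ≤ potWeight Φ μ X := by
  unfold potWeight
  positivity

theorem potNorm_nonneg (Φ : Finset ℤ → Op N) (μ : ℝ) : 0 ≤ potNorm Φ μ :=
  tsum_nonneg fun _ => potWeight_nonneg Φ μ _

theorem FiniteNorm.mono {r : ℝ} (h : FiniteNorm Φ r) (hμ : μ ≤ r) : FiniteNorm Φ μ := by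
  refine Summable.of_nonneg_of_le (fun X => potWeight_nonneg Φ μ X.1) (fun X => ?_) h
  have := Metric.diam_nonneg (s := (X.1 : Set ℤ))
  gcongr

theorem card_shiftFinset (X : Finset ℤ) (x : ℤ) : (shiftFinset X x).card = X.card :=
  Finset.card_image_of_injective _ (add_left_injective x)

theorem diam_shiftFinset (X : Finset ℤ) (x : ℤ) :
    Metric.diam (shiftFinset X x : Set ℤ) = Metric.diam (X : Set ℤ) := by
  rw [shiftFinset, Finset.coe_image]
  exact (isometry_add_right x).diam_image _

theorem potWeight_shiftFinset (hΦ : IsPotential Φ) (X : Finset ℤ) (x : ℤ) :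
    potWeight Φ μ (shiftFinset X x) = potWeight Φ μ X := by
  rw [potWeight, card_shiftFinset, diam_shiftFinset, ← hΦ.translate_eq, norm_translate, potWeight]

theorem shiftFinset_injective (x : ℤ) : Function.Injective fun X => shiftFinset X x :=
  Finset.image_injective (add_left_injective x)

/-- Translation by `-x` carries the sets containing `x` injectively to sets containing `0` and
preserves the weights. -/
theorem sum_potWeight_le (hΦ : IsPotential Φ) (hμ : FiniteNorm Φ μ) (x : ℤ)
    (s : Finset (Finset ℤ)) : ∑ X ∈ s with x ∈ X, potWeight Φ μ X ≤ potNorm Φ μ := by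
  set T := (s.filter (fun X => x ∈ X)).image fun X => shiftFinset X (-x)
  have hT : ∀ X ∈ T, (0 : ℤ) ∈ X := by
    intro X hX
    obtain ⟨Y, hY, rfl⟩ := Finset.mem_image.1 hX
    exact Finset.mem_image.2 ⟨x, (Finset.mem_filter.1 hY).2, by simp⟩
  calc ∑ X ∈ s with x ∈ X, potWeight Φ μ X = ∑ X ∈ T, potWeight Φ μ X := by
        rw [Finset.sum_image (shiftFinset_injective (-x)).injOn]
        exact Finset.sum_congr rfl fun X _ => (potWeight_shiftFinset hΦ X _).symm
    _ = ∑ X ∈ T.subtype (fun X => (0 : ℤ) ∈ X), potWeight Φ μ X.1 :=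
        (Finset.sum_subtype_of_mem (potWeight Φ μ) hT).symm
    _ ≤ potNorm Φ μ := Summable.sum_le_tsum _ (fun X _ => potWeight_nonneg Φ μ X.1) hμ

theorem isSelfAdjoint_hamiltonian (hΦ : IsPotential Φ) (Λ : Finset ℤ) :
    IsSelfAdjoint (hamiltonian Φ Λ) :=
  isSelfAdjoint_sum _ fun X _ => hΦ.isSelfAdjoint X

theorem hamiltonian_mem_localAlg (hΦ : IsPotential Φ) (Λ : Finset ℤ) :
    hamiltonian Φ Λ ∈ localAlg N Λ :=
  sum_mem fun X hX => localAlg_mono N (Finset.mem_powerset.1 hX) (hΦ.mem_localAlg X)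

theorem exp_neg_abs_le (hμ : 0 ≤ μ) {X : Finset ℤ} {x y : ℤ} (hx : x ∈ X) (hy : y ∈ X) :
    Real.exp (-(μ * |(y : ℝ)|))
      ≤ Real.exp (μ * Metric.diam (X : Set ℤ)) * Real.exp (-(μ * |(x : ℝ)|)) := by
  have h1 : dist x y ≤ Metric.diam (X : Set ℤ) :=
    Metric.dist_le_diam_of_mem X.finite_toSet.isBounded hx hy
  rw [Int.dist_eq] at h1
  have h2 : |(x : ℝ)| ≤ |(x : ℝ) - y| + |(y : ℝ)| := by
    simpa using abs_add_le ((x : ℝ) - y) y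
  rw [← Real.exp_add, Real.exp_le_exp]
  nlinarith

/-- The double commutator with the Hamiltonian and a one-site observable. -/
theorem norm_commutator_hamiltonian_le (hΦ : IsPotential Φ) (hμ0 : 0 ≤ μ)
    (hμ : FiniteNorm Φ μ) {S : ℝ} (hS : 0 ≤ S) {B : Op N} (hB : ExpBound μ S B) (Λ : Finset ℤ)
    {x : ℤ} {b : Op N} (hb : b ∈ localAlg N {x}) :
    ‖B * (hamiltonian Φ Λ * b - b * hamiltonian Φ Λ)
        - (hamiltonian Φ Λ * b - b * hamiltonian Φ Λ) * B‖
      ≤ 2 * potNorm Φ μ * (S * Real.exp (-(μ * |(x : ℝ)|)) * ‖b‖) := by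
  set E := Real.exp (-(μ * |(x : ℝ)|))
  have h1 : hamiltonian Φ Λ * b - b * hamiltonian Φ Λ
      = ∑ X ∈ Λ.powerset with x ∈ X, (Φ X * b - b * Φ X) := by
    rw [hamiltonian, Finset.sum_mul, Finset.mul_sum, ← Finset.sum_sub_distrib]
    refine (Finset.sum_filter_of_ne fun X _ hne => ?_).symm
    by_contra hx
    exact hne (sub_eq_zero.2 (commute_of_mem_localAlg (Finset.disjoint_singleton_right.2 hx)
      (hΦ.mem_localAlg X) hb).eq)
  have h2 (X : Finset ℤ) (hX : x ∈ X) :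
      ‖B * (Φ X * b - b * Φ X) - (Φ X * b - b * Φ X) * B‖
        ≤ potWeight Φ μ X * (2 * (S * E * ‖b‖)) := by
    -- Since `x ∈ X`, the inner commutator stays in `𝒜(X)`, so only sites of `X` enter.
    have hbX : b ∈ localAlg N X := localAlg_mono N (Finset.singleton_subset_iff.2 hX) hb
    have hm : Φ X * b - b * Φ X ∈ localAlg N X :=
      sub_mem (mul_mem (hΦ.mem_localAlg X) hbX) (mul_mem hbX (hΦ.mem_localAlg X))
    have hsum : ∑ y ∈ X, commStrength y B
        ≤ X.card * (S * (Real.exp (μ * Metric.diam (X : Set ℤ)) * E)) := by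
      rw [← nsmul_eq_mul]
      refine Finset.sum_le_card_nsmul _ _ _ fun y hy => (hB y).trans ?_
      exact mul_le_mul_of_nonneg_left (exp_neg_abs_le hμ0 hX hy) hS
    calc _ ≤ ((N : ℝ) + 1) ^ (2 * X.card) * ‖Φ X * b - b * Φ X‖ * ∑ y ∈ X, commStrength y B :=
          norm_commutator_le_sum B hm
      _ ≤ ((N : ℝ) + 1) ^ (2 * X.card) * (2 * ‖Φ X‖ * ‖b‖)
          * (X.card * (S * (Real.exp (μ * Metric.diam (X : Set ℤ)) * E))) := by
          have := Finset.sum_nonneg fun y (_ : y ∈ X) => commStrength_nonneg y B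
          gcongr
          exact norm_commutator_le_two _ _
      _ = _ := by rw [potWeight]; ring
  rw [h1, Finset.mul_sum, Finset.sum_mul, ← Finset.sum_sub_distrib]
  calc _ ≤ ∑ X ∈ Λ.powerset with x ∈ X, potWeight Φ μ X * (2 * (S * E * ‖b‖)) :=
        (norm_sum_le _ _).trans (Finset.sum_le_sum fun X hX => h2 X (Finset.mem_filter.1 hX).2)
    _ = (∑ X ∈ Λ.powerset with x ∈ X, potWeight Φ μ X) * (2 * (S * E * ‖b‖)) :=
        (Finset.sum_mul _ _ _).symm
    _ ≤ potNorm Φ μ * (2 * (S * E * ‖b‖)) :=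
        mul_le_mul_of_nonneg_right (sum_potWeight_le hΦ hμ x _) (by positivity)
    _ = _ := by ring

/-! ### Bootstrap to bounds uniform in the region -/

theorem le_sum_exp_mul_exp_neg (μ : ℝ) {K : ℝ} (hK : 0 ≤ K) {Λ : Finset ℤ} {x : ℤ} (hx : x ∈ Λ) :
    K ≤ (∑ y ∈ Λ, K * Real.exp (μ * |(y : ℝ)|)) * Real.exp (-(μ * |(x : ℝ)|)) := by
  calc K = K * Real.exp (μ * |(x : ℝ)|) * Real.exp (-(μ * |(x : ℝ)|)) := by
        rw [mul_assoc, ← Real.exp_add, add_neg_cancel, Real.exp_zero, mul_one]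
    _ ≤ _ := by
        gcongr
        exact Finset.single_le_sum (f := fun y : ℤ => K * Real.exp (μ * |(y : ℝ)|))
          (fun _ _ => by positivity) hx

/-- A crude bound that depends on `Λ` and only starts the bootstrap: inside `Λ` the trivial `2‖A‖`
is used, and outside `Λ` site observables commute with `H_Λ`, so the strength does not grow. -/
theorem exists_expBound_localDynamics (hΦ : IsPotential Φ) (Λ : Finset ℤ) {C : ℝ} {A : Op N}
    (hA : ExpBound μ C A) : ∃ M, 0 ≤ M ∧ ∀ s, ExpBound μ M (localDynamics Φ Λ s A) := by
  have hC := hA.nonneg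
  refine ⟨C + ∑ y ∈ Λ, 2 * ‖A‖ * Real.exp (μ * |(y : ℝ)|), by positivity, fun s x => ?_⟩
  have hH := isSelfAdjoint_hamiltonian hΦ Λ
  rw [localDynamics_eq_heisenberg]
  by_cases hx : x ∈ Λ
  · have h1 := commStrength_le_two_mul_norm x (heisenberg (hamiltonian Φ Λ) s A)
    rw [norm_heisenberg hH] at h1
    refine h1.trans ((le_sum_exp_mul_exp_neg μ (by positivity) hx).trans ?_)
    gcongr
    exact le_add_of_nonneg_left hC
  · calc _ ≤ commStrength x A := by
          refine commStrength_le (commStrength_nonneg x A) fun b hb => ?_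
          have hc : Commute (hamiltonian Φ Λ) b := commute_of_mem_localAlg
            (Finset.disjoint_singleton_right.2 hx) (hamiltonian_mem_localAlg hΦ Λ) hb
          rw [norm_commutator_heisenberg hH, heisenberg_eq_self_of_commute hc]
          exact norm_commutator_le A hb
      _ ≤ C * Real.exp (-(μ * |(x : ℝ)|)) := hA x
      _ ≤ _ := by
          gcongr
          exact le_add_of_nonneg_right (by positivity)

/-- The Duhamel term is at most `2 |t| ‖Φ‖_μ S`; the `4` in the time restriction makes this `S/2`.
-/
theorem expBound_localDynamics_improve (hΦ : IsPotential Φ) (hμ0 : 0 ≤ μ) (hμ : FiniteNorm Φ μ)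
    (Λ : Finset ℤ) {C S : ℝ} (hS : 0 ≤ S) {A : Op N} (hA : ExpBound μ C A) {t : ℝ}
    (ht : |t| * (4 * potNorm Φ μ) ≤ 1)
    (h : ∀ s, |s| ≤ |t| → ExpBound μ S (localDynamics Φ Λ s A)) :
    ExpBound μ (C + S / 2) (localDynamics Φ Λ t A) := by
  intro x
  have hC := hA.nonneg
  refine commStrength_le (by positivity) fun b hb => ?_
  set E := Real.exp (-(μ * |(x : ℝ)|))
  have hk := potNorm_nonneg Φ μ
  calc _ ≤ ‖A * b - b * A‖ + |t| * (2 * potNorm Φ μ * (S * E * ‖b‖)) :=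
        norm_commutator_heisenberg_le (isSelfAdjoint_hamiltonian hΦ Λ) A b fun s hs =>
          norm_commutator_hamiltonian_le hΦ hμ0 hμ hS (h s hs) Λ hb
    _ = ‖A * b - b * A‖ + (|t| * (4 * potNorm Φ μ)) * (S * E * ‖b‖ / 2) := by ring
    _ ≤ C * E * ‖b‖ + 1 * (S * E * ‖b‖ / 2) := by
        refine add_le_add ((norm_commutator_le A hb).trans ?_) ?_
        · exact mul_le_mul_of_nonneg_right (hA x) (norm_nonneg _)
        · exact mul_le_mul_of_nonneg_right ht (by positivity)
    _ = _ := by ring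

theorem expBound_localDynamics_short (hΦ : IsPotential Φ) (hμ0 : 0 ≤ μ) (hμ : FiniteNorm Φ μ)
    (Λ : Finset ℤ) {C : ℝ} {A : Op N} (hA : ExpBound μ C A) {t : ℝ}
    (ht : |t| * (4 * potNorm Φ μ) ≤ 1) :
    ExpBound μ (2 * C) (localDynamics Φ Λ t A) := by
  have hC := hA.nonneg
  obtain ⟨M, hM0, hM⟩ := exists_expBound_localDynamics hΦ Λ hA
  -- The map `S ↦ C + S/2` has the fixed point `2C` and halves the distance to it, so the
  -- `Λ`-dependent `M` disappears as `n → ∞`.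
  have key (n : ℕ) : ∀ s, |s| ≤ |t| →
      ExpBound μ (2 * C + M * (1 / 2) ^ n) (localDynamics Φ Λ s A) := by
    induction n with
    | zero =>
      intro s _ y
      refine (hM s y).trans ?_
      gcongr
      simp [hC]
    | succ n ih =>
      intro s hs
      have hs' : |s| * (4 * potNorm Φ μ) ≤ 1 :=
        (mul_le_mul_of_nonneg_right hs (by have := potNorm_nonneg Φ μ; positivity)).trans ht
      have h := expBound_localDynamics_improve hΦ hμ0 hμ Λ (by positivity) hA hs'
        fun u hu => ih u (hu.trans hs)
      convert h using 1
      ring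
  intro y
  have hlim : Filter.Tendsto (fun n : ℕ => (2 * C + M * (1 / 2 : ℝ) ^ n)
      * Real.exp (-(μ * |(y : ℝ)|))) Filter.atTop
      (nhds ((2 * C + M * 0) * Real.exp (-(μ * |(y : ℝ)|)))) :=
    ((tendsto_pow_atTop_nhds_zero_of_lt_one (by norm_num) (by norm_num)).const_mul M
      |>.const_add _).mul_const _
  have h := ge_of_tendsto' hlim fun n => key n t le_rfl y
  simpa using h

theorem localDynamics_add_time (Φ : Finset ℤ → Op N) (Λ : Finset ℤ) (s t : ℝ) (A : Op N) :
    localDynamics Φ Λ (s + t) A = localDynamics Φ Λ s (localDynamics Φ Λ t A) :=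
  heisenberg_add_time _ _ _ _

theorem expBound_localDynamics_nat_mul (hΦ : IsPotential Φ) (hμ0 : 0 ≤ μ) (hμ : FiniteNorm Φ μ)
    (Λ : Finset ℤ) {C : ℝ} {A : Op N} (hA : ExpBound μ C A) {t : ℝ}
    (ht : |t| * (4 * potNorm Φ μ) ≤ 1) (n : ℕ) :
    ExpBound μ (2 ^ n * C) (localDynamics Φ Λ (n * t) A) := by
  induction n with
  | zero => simpa [localDynamics_eq_heisenberg, heisenberg_zero_time] using hA
  | succ n ih =>
    have h := expBound_localDynamics_short hΦ hμ0 hμ Λ ih ht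
    rw [← localDynamics_add_time] at h
    convert h using 1
    · ring
    · congr 1
      push_cast
      ring

/-- Exponential localization propagates uniformly in the region and on bounded time intervals. -/
theorem exists_expBound_localDynamics_uniform (hΦ : IsPotential Φ) (hμ0 : 0 ≤ μ)
    (hμ : FiniteNorm Φ μ) (T : ℝ) : ∃ G : ℝ, 0 ≤ G ∧ ∀ (Λ : Finset ℤ) (C : ℝ) (A : Op N),
      ExpBound μ C A → ∀ s, |s| ≤ T → ExpBound μ (G * C) (localDynamics Φ Λ s A) := by
  have hk := potNorm_nonneg Φ μ
  obtain ⟨n, hn⟩ := exists_nat_ge (T * (4 * potNorm Φ μ))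
  refine ⟨2 ^ (n + 1), by positivity, fun Λ C A hA s hs => ?_⟩
  have hn0 : (0 : ℝ) < (n + 1 : ℕ) := by positivity
  -- The time is cut into `n + 1` short steps, each doubling the constant; `n + 1` rather than `n`
  -- avoids division by zero.
  have h := expBound_localDynamics_nat_mul hΦ hμ0 hμ Λ hA (t := s / (n + 1 : ℕ)) ?_ (n + 1)
  · rwa [mul_div_cancel₀ _ hn0.ne'] at h
  · rw [abs_div, abs_of_pos hn0, div_mul_eq_mul_div, div_le_one hn0]
    calc _ ≤ T * (4 * potNorm Φ μ) := by gcongr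
      _ ≤ n := hn
      _ ≤ _ := by push_cast; linarith

end

/-! ### The thermodynamic limit of the dynamics -/

theorem summable_exp_neg_mul_abs {μ : ℝ} (hμ : 0 < μ) :
    Summable fun y : ℤ => Real.exp (-(μ * |(y : ℝ)|)) := by
  have h : Summable fun n : ℕ => Real.exp (-(μ * (n : ℝ))) := by
    have h1 := Real.summable_exp_nat_mul_iff.2 (neg_lt_zero.2 hμ)
    refine h1.congr fun n => ?_
    congr 1
    ring
  refine summable_int_iff_summable_nat_and_neg.2 ⟨?_, ?_⟩ <;> simpa using h

section

variable {N : ℕ} {Φ : Finset ℤ → Op N} {μ : ℝ}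

theorem mul_norm_le_potWeight (hμ : 0 ≤ μ) {X : Finset ℤ} {x : ℤ} (hx : x ∈ X) :
    ((N : ℝ) + 1) ^ (2 * X.card) * ‖Φ X‖ ≤ potWeight Φ μ X := by
  have h1 : (1 : ℝ) ≤ X.card := by exact_mod_cast Finset.card_pos.2 ⟨x, hx⟩
  have h2 : 1 ≤ Real.exp (μ * Metric.diam (X : Set ℤ)) :=
    Real.one_le_exp (mul_nonneg hμ Metric.diam_nonneg)
  calc _ = 1 * ((N : ℝ) + 1) ^ (2 * X.card) * 1 * ‖Φ X‖ := by ring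
    _ ≤ _ := by unfold potWeight; gcongr

/-- Exchanging the sums, the sets through a fixed `y` contribute at most `‖Φ‖_μ e^(-μ|y|)`, which is
summable over `y`. -/
theorem summable_mul_norm_mul_sum_exp (hΦ : IsPotential Φ) (hμ0 : 0 < μ) (hμ : FiniteNorm Φ μ) :
    Summable fun X : Finset ℤ => ((N : ℝ) + 1) ^ (2 * X.card) * ‖Φ X‖
      * ∑ y ∈ X, Real.exp (-(μ * |(y : ℝ)|)) := by
  refine summable_of_sum_le (c := potNorm Φ μ * ∑' y : ℤ, Real.exp (-(μ * |(y : ℝ)|)))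
    (fun X => by positivity) fun s => ?_
  set U : Finset ℤ := s.biUnion id
  have h1 (X : Finset ℤ) (hX : X ∈ s) : ((N : ℝ) + 1) ^ (2 * X.card) * ‖Φ X‖
      * ∑ y ∈ X, Real.exp (-(μ * |(y : ℝ)|))
      ≤ ∑ y ∈ U, if y ∈ X then potWeight Φ μ X * Real.exp (-(μ * |(y : ℝ)|)) else 0 := by
    have hXU : X ⊆ U := Finset.subset_biUnion_of_mem id hX
    rw [← Finset.sum_filter, Finset.filter_mem_eq_inter, Finset.inter_eq_right.2 hXU,
      Finset.mul_sum]
    refine Finset.sum_le_sum fun y hy => ?_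
    exact mul_le_mul_of_nonneg_right (mul_norm_le_potWeight hμ0.le hy) (Real.exp_pos _).le
  calc _ ≤ ∑ X ∈ s, ∑ y ∈ U, if y ∈ X then potWeight Φ μ X * Real.exp (-(μ * |(y : ℝ)|)) else 0 :=
        Finset.sum_le_sum h1
    _ = ∑ y ∈ U, (∑ X ∈ s with y ∈ X, potWeight Φ μ X) * Real.exp (-(μ * |(y : ℝ)|)) := by
        rw [Finset.sum_comm]
        refine Finset.sum_congr rfl fun y _ => ?_
        rw [Finset.sum_mul, Finset.sum_filter]
    _ ≤ ∑ y ∈ U, potNorm Φ μ * Real.exp (-(μ * |(y : ℝ)|)) :=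
        Finset.sum_le_sum fun y _ =>
          mul_le_mul_of_nonneg_right (sum_potWeight_le hΦ hμ y s) (Real.exp_pos _).le
    _ = potNorm Φ μ * ∑ y ∈ U, Real.exp (-(μ * |(y : ℝ)|)) := (Finset.mul_sum _ _ _).symm
    _ ≤ _ := mul_le_mul_of_nonneg_left
        ((summable_exp_neg_mul_abs hμ0).sum_le_tsum _ fun _ _ => (Real.exp_pos _).le)
        (potNorm_nonneg Φ μ)

theorem hamiltonian_sub (Φ : Finset ℤ → Op N) {Λ Λ' : Finset ℤ} (h : Λ ⊆ Λ') :
    hamiltonian Φ Λ' - hamiltonian Φ Λ = ∑ X ∈ Λ'.powerset \ Λ.powerset, Φ X := by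
  rw [hamiltonian, hamiltonian, ← Finset.sum_sdiff (Finset.powerset_mono.2 h), add_sub_cancel_right]

theorem norm_commutator_sum_le (hΦ : IsPotential Φ) {C : ℝ} {B : Op N} (hB : ExpBound μ C B)
    (s : Finset (Finset ℤ)) :
    ‖B * (∑ X ∈ s, Φ X) - (∑ X ∈ s, Φ X) * B‖ ≤ C * ∑ X ∈ s, ((N : ℝ) + 1) ^ (2 * X.card) * ‖Φ X‖
      * ∑ y ∈ X, Real.exp (-(μ * |(y : ℝ)|)) := by
  rw [Finset.mul_sum, Finset.sum_mul, ← Finset.sum_sub_distrib, Finset.mul_sum]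
  refine (norm_sum_le _ _).trans (Finset.sum_le_sum fun X _ => ?_)
  calc _ ≤ ((N : ℝ) + 1) ^ (2 * X.card) * ‖Φ X‖ * ∑ y ∈ X, commStrength y B :=
        norm_commutator_le_sum B (hΦ.mem_localAlg X)
    _ ≤ ((N : ℝ) + 1) ^ (2 * X.card) * ‖Φ X‖ * ∑ y ∈ X, C * Real.exp (-(μ * |(y : ℝ)|)) := by
        gcongr with y
        exact hB y
    _ = _ := by rw [← Finset.mul_sum]; ring

theorem cauchySeq_localDynamics_of_expBound (hΦ : IsPotential Φ) (hμ0 : 0 < μ)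
    (hμ : FiniteNorm Φ μ) {C : ℝ} {A : Op N} (hA : ExpBound μ C A) (t : ℝ) :
    CauchySeq fun Λ : Finset ℤ => localDynamics Φ Λ t A := by
  have hC := hA.nonneg
  obtain ⟨G, hG, hGA⟩ := exists_expBound_localDynamics_uniform hΦ hμ0.le hμ |t|
  rw [Metric.cauchySeq_iff']
  intro ε hε
  have hK : 0 < |t| * (G * C) + 1 := by positivity
  obtain ⟨s, hs⟩ := summable_iff_vanishing_norm.1 (summable_mul_norm_mul_sum_exp hΦ hμ0 hμ)
    (ε / (|t| * (G * C) + 1)) (by positivity)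
  -- A set not contained in the union of `s` is not a member of `s`, so the extra terms of `H_Λ` lie
  -- in the tail of the series.
  refine ⟨s.biUnion id, fun Λ hΛ => ?_⟩
  set Λ₀ : Finset ℤ := s.biUnion id
  set q : Finset (Finset ℤ) := Λ.powerset \ Λ₀.powerset
  have hq : Disjoint q s := Finset.disjoint_left.2 fun X hX hXs =>
    (Finset.mem_sdiff.1 hX).2 (Finset.mem_powerset.2 (Finset.subset_biUnion_of_mem id hXs))
  have h1 := (le_abs_self _).trans_lt (hs q hq)
  set w := ∑ X ∈ q, ((N : ℝ) + 1) ^ (2 * X.card) * ‖Φ X‖ * ∑ y ∈ X, Real.exp (-(μ * |(y : ℝ)|))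
  have hw : 0 ≤ w := Finset.sum_nonneg fun X _ => by positivity
  rw [dist_eq_norm]
  calc _ ≤ |t| * (G * C * w) := by
        refine norm_heisenberg_sub_le (isSelfAdjoint_hamiltonian hΦ Λ) A fun u hu => ?_
        rw [hamiltonian_sub Φ hΛ]
        exact norm_commutator_sum_le hΦ (hGA Λ₀ C A hA u hu) q
    _ ≤ (|t| * (G * C) + 1) * w := by linarith
    _ < (|t| * (G * C) + 1) * (ε / (|t| * (G * C) + 1)) := mul_lt_mul_of_pos_left h1 hK
    _ = ε := mul_div_cancel₀ ε hK.ne'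

theorem exists_expBound_of_mem_localAlg (μ : ℝ) {Λ : Finset ℤ} {A : Op N}
    (hA : A ∈ localAlg N Λ) : ∃ C, ExpBound μ C A := by
  refine ⟨∑ y ∈ Λ, 2 * ‖A‖ * Real.exp (μ * |(y : ℝ)|), fun x => ?_⟩
  by_cases hx : x ∈ Λ
  · exact (commStrength_le_two_mul_norm x A).trans
      (le_sum_exp_mul_exp_neg μ (by positivity) hx)
  · rw [commStrength_eq_zero_of_mem_localAlg hA hx]
    positivity

/-- An `ε/3` argument: local observables are dense and every local dynamics is isometric. -/
theorem cauchySeq_localDynamics (hΦ : IsPotential Φ) (hμ0 : 0 < μ) (hμ : FiniteNorm Φ μ)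
    {A : Op N} (hA : A ∈ quasiLocal N) (t : ℝ) :
    CauchySeq fun Λ : Finset ℤ => localDynamics Φ Λ t A := by
  have hA' : A ∈ (quasiLocal N : Set (Op N)) := hA
  rw [coe_quasiLocal] at hA'
  rw [Metric.cauchySeq_iff']
  intro ε hε
  obtain ⟨B, hB, hAB⟩ := Metric.mem_closure_iff.1 hA' (ε / 3) (by positivity)
  obtain ⟨Λ, hΛ⟩ := Set.mem_iUnion.1 hB
  obtain ⟨C, hC⟩ := exists_expBound_of_mem_localAlg μ hΛ
  obtain ⟨Λ₀, h0⟩ := Metric.cauchySeq_iff'.1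
    (cauchySeq_localDynamics_of_expBound hΦ hμ0 hμ hC t) (ε / 3) (by positivity)
  have hd (Λ' : Finset ℤ) : dist (localDynamics Φ Λ' t A) (localDynamics Φ Λ' t B) < ε / 3 := by
    rw [dist_eq_norm, localDynamics_eq_heisenberg, localDynamics_eq_heisenberg,
      ← heisenberg_sub, norm_heisenberg (isSelfAdjoint_hamiltonian hΦ Λ'), ← dist_eq_norm]
    exact hAB
  refine ⟨Λ₀, fun Λ' hΛ' => ?_⟩
  have h1 := dist_triangle4 (localDynamics Φ Λ' t A) (localDynamics Φ Λ' t B)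
    (localDynamics Φ Λ₀ t B) (localDynamics Φ Λ₀ t A)
  have h2 := hd Λ₀
  rw [dist_comm] at h2
  linarith [hd Λ', h0 Λ' hΛ']

theorem exists_tendsto_localDynamics (hΦ : IsPotential Φ) (hμ0 : 0 < μ) (hμ : FiniteNorm Φ μ)
    (t : ℝ) (A : quasiLocal N) : ∃ B : quasiLocal N,
      Filter.Tendsto (fun Λ : Finset ℤ => localDynamics Φ Λ t (A : Op N)) Filter.atTop
        (nhds (B : Op N)) := by
  obtain ⟨B, hB⟩ := cauchySeq_tendsto_of_complete (cauchySeq_localDynamics hΦ hμ0 hμ A.2 t)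
  refine ⟨⟨B, ?_⟩, hB⟩
  exact (isClosed_quasiLocal N).mem_of_tendsto hB (Filter.Eventually.of_forall fun Λ =>
    heisenberg_mem _ (isClosed_quasiLocal N)
      (mem_quasiLocal_of_mem_localAlg (hamiltonian_mem_localAlg hΦ Λ)) A.2 t)

theorem exists_dynamics (hΦ : IsPotential Φ) (hμ0 : 0 < μ) (hμ : FiniteNorm Φ μ) :
    ∃ α : ℝ → (quasiLocal N ≃⋆ₐ[ℂ] quasiLocal N),
      (∀ (s t : ℝ) (A : quasiLocal N), α (s + t) A = α s (α t A)) ∧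
      ∀ (t : ℝ) (A : quasiLocal N),
        Filter.Tendsto (fun Λ : Finset ℤ => localDynamics Φ Λ t (A : Op N))
          Filter.atTop (nhds (α t A : Op N)) := by
  choose β hβ using exists_tendsto_localDynamics hΦ hμ0 hμ
  -- Uniqueness of limits transfers each algebraic identity from the local dynamics to `β`.
  have hunique {t : ℝ} {A B : quasiLocal N} (h : Filter.Tendsto
      (fun Λ : Finset ℤ => localDynamics Φ Λ t (A : Op N)) Filter.atTop (nhds (B : Op N))) :
      β t A = B := Subtype.ext (tendsto_nhds_unique (hβ t A) h)
  have hgroup (s t : ℝ) (A : quasiLocal N) : β (s + t) A = β s (β t A) := by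
    refine hunique ?_
    -- Isometry allows the inner evolution to be replaced by its limit while the outer one still
    -- varies with `Λ`.
    have h1 : Filter.Tendsto (fun Λ : Finset ℤ => localDynamics Φ Λ s
        (localDynamics Φ Λ t (A : Op N) - (β t A : Op N))) Filter.atTop (nhds 0) := by
      rw [tendsto_zero_iff_norm_tendsto_zero]
      refine (tendsto_iff_norm_sub_tendsto_zero.1 (hβ t A)).congr fun Λ => ?_
      exact (norm_heisenberg (isSelfAdjoint_hamiltonian hΦ Λ) s _).symm
    have h2 := h1.add (hβ s (β t A))
    rw [zero_add] at h2
    refine h2.congr fun Λ => ?_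
    rw [localDynamics_add_time]
    simp only [localDynamics_eq_heisenberg, heisenberg_sub, sub_add_cancel]
  have hzero (A : quasiLocal N) : β 0 A = A := hunique <|
    tendsto_const_nhds.congr fun Λ => (heisenberg_zero_time (hamiltonian Φ Λ) (A : Op N)).symm
  refine ⟨fun t =>
    { toFun := β t
      invFun := β (-t)
      left_inv := fun A => by rw [← hgroup, neg_add_cancel, hzero]
      right_inv := fun A => by rw [← hgroup, add_neg_cancel, hzero]
      map_mul' := fun A B => hunique <| ((hβ t A).mul (hβ t B)).congr fun Λ =>
        (heisenberg_mul (hamiltonian Φ Λ) t (A : Op N) B).symm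
      map_add' := fun A B => hunique <| ((hβ t A).add (hβ t B)).congr fun Λ =>
        (heisenberg_add (hamiltonian Φ Λ) t (A : Op N) B).symm
      map_star' := fun A => hunique <| (hβ t A).star.congr fun Λ =>
        (heisenberg_star (isSelfAdjoint_hamiltonian hΦ Λ) t (A : Op N)).symm
      map_smul' := fun c A => hunique <| ((hβ t A).const_smul c).congr fun Λ =>
        (heisenberg_smul (hamiltonian Φ Λ) t c (A : Op N)).symm }, hgroup, hβ⟩

/-! ### The algebra of exponentially localized elements -/

/-- Convergence along the cofinite filter gives boundedness over all sites; conversely, halving the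
rate turns a bound into decay. -/
theorem mem_expLocal_iff (A : quasiLocal N) :
    A ∈ expLocal N ↔ ∃ μ : ℝ, 0 < μ ∧ ∃ C, ExpBound μ C (A : Op N) := by
  constructor
  · rintro ⟨μ, hμ, h⟩
    obtain ⟨C, hC⟩ := h.bddAbove_range_of_cofinite
    refine ⟨μ, hμ, C, fun y => ?_⟩
    have h1 := hC ⟨y, rfl⟩
    rw [Real.exp_neg, ← div_eq_mul_inv, le_div_iff₀ (Real.exp_pos _), mul_comm]
    exact h1
  · rintro ⟨μ, hμ, C, hC⟩
    refine ⟨μ / 2, half_pos hμ, ?_⟩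
    have h1 := (summable_exp_neg_mul_abs (half_pos hμ)).tendsto_cofinite_zero.const_mul C
    rw [mul_zero] at h1
    refine squeeze_zero (fun x => mul_nonneg (Real.exp_pos _).le (commStrength_nonneg _ _))
      (fun x => ?_) h1
    calc _ ≤ Real.exp (μ / 2 * |(x : ℝ)|) * (C * Real.exp (-(μ * |(x : ℝ)|))) :=
          mul_le_mul_of_nonneg_left (hC x) (Real.exp_pos _).le
      _ = C * (Real.exp (μ / 2 * |(x : ℝ)|) * Real.exp (-(μ * |(x : ℝ)|))) := by ring
      _ = _ := by
          rw [← Real.exp_add]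
          ring_nf

theorem ExpBound.mono {ν C : ℝ} {A : Op N} (h : ExpBound μ C A) (hν : ν ≤ μ) :
    ExpBound ν C A := fun y => (h y).trans <| by
  have := h.nonneg
  gcongr

/-- For each fixed site observable the commutator norm is continuous in `A`, so a common bound
passes to the limit. -/
theorem ExpBound.of_tendsto {ι : Type*} {l : Filter ι} [l.NeBot] {C : ℝ} {u : ι → Op N}
    {A : Op N} (hu : ∀ i, ExpBound μ C (u i)) (h : Filter.Tendsto u l (nhds A)) :
    ExpBound μ C A := by
  intro y
  rcases isEmpty_or_nonempty ι with hι | ⟨⟨i⟩⟩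
  · exact (Filter.NeBot.ne ‹_› (Filter.filter_eq_bot_of_isEmpty l)).elim
  have hC := (hu i).nonneg
  refine commStrength_le (by positivity) fun b hb => ?_
  refine le_of_tendsto' ((h.mul_const b).sub (h.const_mul b)).norm fun i => ?_
  exact (norm_commutator_le _ hb).trans (mul_le_mul_of_nonneg_right (hu i y) (norm_nonneg b))

theorem add_mem_expLocal {A B : quasiLocal N} (hA : A ∈ expLocal N) (hB : B ∈ expLocal N) :
    A + B ∈ expLocal N := by
  rw [mem_expLocal_iff] at *
  obtain ⟨μ, hμ, C, hC⟩ := hA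
  obtain ⟨ν, hν, D, hD⟩ := hB
  refine ⟨min μ ν, lt_min hμ hν, C + D, fun y => ?_⟩
  rw [add_mul]
  exact (commStrength_add_le y _ _).trans
    (add_le_add (hC.mono (min_le_left μ ν) y) (hD.mono (min_le_right μ ν) y))

theorem mul_mem_expLocal {A B : quasiLocal N} (hA : A ∈ expLocal N) (hB : B ∈ expLocal N) :
    A * B ∈ expLocal N := by
  rw [mem_expLocal_iff] at *
  obtain ⟨μ, hμ, C, hC⟩ := hA
  obtain ⟨ν, hν, D, hD⟩ := hB
  refine ⟨min μ ν, lt_min hμ hν, ‖(A : Op N)‖ * D + ‖(B : Op N)‖ * C, fun y => ?_⟩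
  refine (commStrength_mul_le y (A : Op N) B).trans ?_
  rw [add_mul, mul_assoc, mul_assoc]
  gcongr
  · exact hD.mono (min_le_right μ ν) y
  · exact hC.mono (min_le_left μ ν) y

theorem star_mem_expLocal {A : quasiLocal N} (hA : A ∈ expLocal N) : star A ∈ expLocal N := by
  rw [mem_expLocal_iff] at *
  obtain ⟨μ, hμ, C, hC⟩ := hA
  exact ⟨μ, hμ, C, fun y => (commStrength_star_le y (A : Op N)).trans (hC y)⟩

theorem algebraMap_mem_expLocal (c : ℂ) : algebraMap ℂ (quasiLocal N) c ∈ expLocal N := by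
  rw [mem_expLocal_iff]
  refine ⟨1, one_pos, 0, fun y => ?_⟩
  rw [zero_mul]
  exact (commStrength_eq_zero_of_forall_commute fun b _ => Algebra.commutes c b).le

/-- The star subalgebra of exponentially localized elements. -/
def expLocalAlg (N : ℕ) : StarSubalgebra ℂ (quasiLocal N) where
  carrier := expLocal N
  mul_mem' := mul_mem_expLocal
  add_mem' := add_mem_expLocal
  algebraMap_mem' := algebraMap_mem_expLocal
  star_mem' := star_mem_expLocal

theorem mem_expLocal_of_tendsto_localDynamics (hΦ : IsPotential Φ) {r : ℝ} (hr0 : 0 < r)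
    (hr : FiniteNorm Φ r) {t : ℝ} {A B : quasiLocal N} (hA : A ∈ expLocal N)
    (h : Filter.Tendsto (fun Λ : Finset ℤ => localDynamics Φ Λ t (A : Op N)) Filter.atTop
      (nhds (B : Op N))) : B ∈ expLocal N := by
  rw [mem_expLocal_iff] at *
  obtain ⟨μ, hμ, C, hC⟩ := hA
  have hν : 0 < min μ r := lt_min hμ hr0
  obtain ⟨G, -, hG⟩ := exists_expBound_localDynamics_uniform hΦ hν.le
    (hr.mono (min_le_right μ r)) |t|
  -- The rate is limited both by that of `A` and by the decay of the potential; it does not depend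
  -- on `t`.
  exact ⟨min μ r, hν, G * C, ExpBound.of_tendsto
    (fun Λ => hG Λ C A (hC.mono (min_le_left μ r)) t le_rfl) h⟩

end

end SpinChain

end

theorem mainTheorem2 (N : ℕ) (Φ : Finset ℤ → SpinChain.Op N) (hΦ : SpinChain.IsPotential Φ)
    (hnorm : ∃ r : ℝ, 0 < r ∧ SpinChain.FiniteNorm Φ r) :
    ∃ α : ℝ → (SpinChain.quasiLocal N ≃⋆ₐ[ℂ] SpinChain.quasiLocal N),
      (∀ (s t : ℝ) (A : SpinChain.quasiLocal N), α (s + t) A = α s (α t A)) ∧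
      (∀ (t : ℝ) (A : SpinChain.quasiLocal N),
        Filter.Tendsto (fun Λ : Finset ℤ => SpinChain.localDynamics Φ Λ t (A : SpinChain.Op N))
          Filter.atTop (nhds (α t A : SpinChain.Op N))) ∧
      (∃ S : StarSubalgebra ℂ (SpinChain.quasiLocal N),
        (S : Set (SpinChain.quasiLocal N)) = SpinChain.expLocal N) ∧
      ∀ t : ℝ, (fun A => α t A) '' SpinChain.expLocal N = SpinChain.expLocal N := by
  obtain ⟨r, hr0, hr⟩ := hnorm
  obtain ⟨α, hgroup, hα⟩ := SpinChain.exists_dynamics hΦ hr0 hr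
  have hmem (t : ℝ) {A : SpinChain.quasiLocal N} (hA : A ∈ SpinChain.expLocal N) :
      α t A ∈ SpinChain.expLocal N :=
    SpinChain.mem_expLocal_of_tendsto_localDynamics hΦ hr0 hr hA (hα t A)
  -- The group law makes `α 0` idempotent, and an injective idempotent is the identity.
  have hzero (A : SpinChain.quasiLocal N) : α 0 A = A := (α 0).injective <| by
    change α 0 (α 0 A) = α 0 A
    rw [← hgroup, add_zero]
  refine ⟨α, hgroup, hα, ⟨SpinChain.expLocalAlg N, rfl⟩, fun t => Set.Subset.antisymm ?_ ?_⟩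
  · rintro _ ⟨A, hA, rfl⟩
    exact hmem t hA
  · intro A hA
    refine ⟨α (-t) A, hmem (-t) hA, ?_⟩
    change α t (α (-t) A) = A
    rw [← hgroup, add_neg_cancel, hzero]
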